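/- Let $n\ge 2$, $A=[a_{ij}]\in\mathbb C^{n\times n}$ with spectrum $\sigma(A)$, and let $D_n^P$ be the set of diagonal matrices of order $n$ with positive diagonal. Put $r_i(A)=\sum_{j\ne i}|a_{ij}|$, $c_i(A)=\sum_{j\ne i}|a_{ji}|$, and for $X,Y\in D_n^P$ put $r_i^X=r_i(X^{-1}AX)$, $c_i^Y=c_i(Y^{-1}AY)$. Let $\tilde r_i(A)$, $\tilde c_i(A)$ be the same sums restricted to those $j\neq i$ whose index lies in the same diagonal block of the Frobenius normal form of $A$ as $i$ (i.e. $i$ and $j$ lie in the same strongly connected component of the directed graph of $A$), and put $\tilde r_i^X=\tilde r_i(X^{-1}AX)$, $\tilde c_i^Y=\tilde c_i(Y^{-1}AY)$. For nonnegative vectors $g,h\in\mathbb R^n$ and $\alpha,\beta\in[0,1]$ (with $0^0=1$, and writing $\alpha'=1-\alpha$, $\beta'=1-\beta$) define * for $k=1,\dots,4$ the disks $\Gamma_i^{(k)}=\{z:|z-a_{ii}|\le\rho_i^{(k)}\}$, where $\rho_i^{(1)},\dots,\rho_i^{(4)}$ are $g_i$, $h_i$, $g_i^{\alpha}h_i^{\alpha'}$,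 $\alpha g_i+\alpha' h_i$; * for $k=5,\dots,15$ and $i\ne j$ the ovals $\Gamma_{ij}^{(k)}=\{z:|z-a_{ii}||z-a_{jj}|\le\rho_{ij}^{(k)}\}$, where $\rho^{(5)}=g_ig_j$, $\rho^{(6)}=h_ih_j$, $\rho^{(7)}=g_ih_j$, $\rho^{(8)}=(g_ig_j)^{\alpha}(h_ih_j)^{\alpha'}$, $\rho^{(9)}=(g_ih_j)^{\alpha}(g_jh_i)^{\alpha'}$, $\rho^{(10)}=\alpha g_ig_j+\alpha' h_ih_j$, $\rho^{(11)}=\alpha g_ih_j+\alpha' g_jh_i$, $\rho^{(12)}=(\alpha g_i+\alpha' h_i)(\alpha g_j+\alpha' h_j)$, $\rho^{(13)}=(\alpha g_i+\alpha' h_i)(\alpha h_j+\alpha' g_j)$, $\rho^{(14)}=(\alpha g_i+\alpha' h_j)(\alpha g_j+\alpha' h_i)$, $\rho^{(15)}=(\alpha g_i+\alpha' g_j)(\alpha h_j+\alpha' h_i)$; * for $k=16,\dots,31$ and $i\ne j$ the ovals $\Gamma_{ij}^{(k)}=\{z:|z-a_{ii}|^{\alpha}|z-a_{jj}|^{\alpha'}\le\rho_{ij}^{(k)}\}$,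 where $\rho^{(16)}=g_i^{\alpha}g_j^{\alpha'}$, $\rho^{(17)}=h_i^{\alpha}h_j^{\alpha'}$, $\rho^{(18)}=g_i^{\alpha}h_j^{\alpha'}$, $\rho^{(19)}=\alpha g_i+\alpha' g_j$, $\rho^{(20)}=\alpha h_i+\alpha' h_j$, $\rho^{(21)}=\alpha g_i+\alpha' h_j$, $\rho^{(22)}=(g_i^{\beta}h_i^{\beta'})^{\alpha}(g_j^{\beta}h_j^{\beta'})^{\alpha'}$, $\rho^{(23)}=(g_i^{\beta}h_i^{\beta'})^{\alpha}(h_j^{\beta}g_j^{\beta'})^{\alpha'}$, $\rho^{(24)}=\beta g_i^{\alpha}g_j^{\alpha'}+\beta' h_i^{\alpha}h_j^{\alpha'}$, $\rho^{(25)}=\beta g_i^{\alpha}h_j^{\alpha'}+\beta' h_i^{\alpha}g_j^{\alpha'}$, $\rho^{(26)}=\alpha g_i^{\beta}h_i^{\beta'}+\alpha' g_j^{\beta}h_j^{\beta'}$, $\rho^{(27)}=\alpha g_i^{\beta}h_i^{\beta'}+\alpha' h_j^{\beta}g_j^{\beta'}$, $\rho^{(28)}=(\beta g_i+\beta' h_i)^{\alpha}(\beta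 g_j+\beta' h_j)^{\alpha'}$, $\rho^{(29)}=(\beta g_i+\beta' h_i)^{\alpha}(\beta h_j+\beta' g_j)^{\alpha'}$, $\rho^{(30)}=(\alpha g_i+\alpha' g_j)^{\beta}(\alpha h_i+\alpha' h_j)^{\beta'}$, $\rho^{(31)}=(\alpha g_i+\alpha' h_j)^{\beta}(\alpha h_i+\alpha' g_j)^{\beta'}$. Let $\Gamma^{(k)}(A,g,h,\alpha,\beta)$ be the union of the disks over $i$ ($k\le4$), resp. of the ovals over $i\ne j$ ($k\ge5$). Let ${\bf\Gamma}^{(k)}(A,r,c)=\bigcap_{X,Y\in D_n^P;\ \alpha,\beta\in[0,1]}\Gamma^{(k)}(A,r^X,c^Y,\alpha,\beta)$ and likewise ${\bf\Gamma}^{(k)}(A,\tilde r,\tilde c)$ with $(\tilde r^X,\tilde c^Y)$ in place of $(r^X,c^Y)$. **Theorem.** For all $X,Y\in D_n^P$ and $\alpha,\beta\in[0,1]$, with $(g,h)=(r^X,c^Y)$: (a) for every $\lambda\in\sigma(A)$: for each $k=1,\dots,4$ there is $i$ with $\lambda\in\Gamma_i^{(k)}$, and for each $k=5,\dots,31$ there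 are $i\ne j$ with $\lambda\in\Gamma_{ij}^{(k)}$; (b) $\sigma(A)\subseteq{\bf\Gamma}^{(k)}(A,r,c)\subseteq\Gamma^{(k)}(A,r^X,c^Y,\alpha,\beta)$ for $k=1,\dots,31$; (c) $\sigma(A)\subseteq\bigcap_{k=1}^{31}{\bf\Gamma}^{(k)}(A,r,c)={\bf\Gamma}^{(22)}(A,r,c)\cap{\bf\Gamma}^{(23)}(A,r,c)$, and this set is contained in Varga's minimal Geršgorin set $\bigcap_{X\in D_n^P}\bigcup_{i}\{z:|z-a_{ii}|\le r_i^X\}$. Moreover, (a) and (b) also hold with $(\tilde r^X,\tilde c^Y)$ in place of $(r^X,c^Y)$, and $\sigma(A)\subseteq\bigcap_{k=1}^{31}{\bf\Gamma}^{(k)}(A,\tilde r,\tilde c)={\bf\Gamma}^{(18)}(A,\tilde r,\tilde c)$. -/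

import Mathlib

/-- The `i`-th deleted absolute row sum `r_i(A)`. -/
noncomputable def delRowSum {n : ℕ} (A : Matrix (Fin n) (Fin n) ℂ) (i : Fin n) : ℝ :=
  ∑ j ∈ Finset.univ.erase i, ‖A i j‖

/-- The `i`-th deleted absolute column sum `c_i(A)`. -/
noncomputable def delColSum {n : ℕ} (A : Matrix (Fin n) (Fin n) ℂ) (i : Fin n) : ℝ :=
  ∑ j ∈ Finset.univ.erase i, ‖A j i‖

/-- `i` and `j` belong to the same strongly connected component of the directed graph of `A`
(an edge from `a` to `b` when `A a b ≠ 0`), i.e. to the same diagonal block of the Frobenius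
normal form of `A`. -/
def SameBlock {n : ℕ} (A : Matrix (Fin n) (Fin n) ℂ) (i j : Fin n) : Prop :=
  Relation.ReflTransGen (fun a b => A a b ≠ 0) i j ∧
    Relation.ReflTransGen (fun a b => A a b ≠ 0) j i

open Classical in
/-- `r̃_i(A)`: the deleted absolute row sum inside the diagonal block, of the Frobenius normal
form of `A`, that contains the index `i`. -/
noncomputable def blockRowSum {n : ℕ} (A : Matrix (Fin n) (Fin n) ℂ) (i : Fin n) : ℝ :=
  ∑ j ∈ (Finset.univ.erase i).filter (fun j => SameBlock A i j), ‖A i j‖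

open Classical in
/-- `c̃_i(A)`: the deleted absolute column sum inside the diagonal block, of the Frobenius normal
form of `A`, that contains the index `i`. -/
noncomputable def blockColSum {n : ℕ} (A : Matrix (Fin n) (Fin n) ℂ) (i : Fin n) : ℝ :=
  ∑ j ∈ (Finset.univ.erase i).filter (fun j => SameBlock A i j), ‖A j i‖

/-- Diagonal matrices of order `n` with positive diagonal, given by their diagonals. -/
abbrev PosDiag (n : ℕ) : Type := {x : Fin n → ℝ // ∀ i, 0 < x i}

/-- The diagonal similarity `X⁻¹ A X`. -/
noncomputable def diagConj {n : ℕ} (X : PosDiag n) (A : Matrix (Fin n) (Fin n) ℂ) :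
    Matrix (Fin n) (Fin n) ℂ :=
  Matrix.diagonal (fun i => ((X.1 i : ℂ))⁻¹) * A * Matrix.diagonal (fun i => (X.1 i : ℂ))

/-- `r^X(A) = r(X⁻¹ A X)`. -/
noncomputable def wRow {n : ℕ} (A : Matrix (Fin n) (Fin n) ℂ) (X : PosDiag n) : Fin n → ℝ :=
  delRowSum (diagConj X A)

/-- `c^Y(A) = c(Y⁻¹ A Y)`. -/
noncomputable def wCol {n : ℕ} (A : Matrix (Fin n) (Fin n) ℂ) (Y : PosDiag n) : Fin n → ℝ :=
  delColSum (diagConj Y A)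

/-- `r̃^X(A) = r̃(X⁻¹ A X)`. -/
noncomputable def wBlockRow {n : ℕ} (A : Matrix (Fin n) (Fin n) ℂ) (X : PosDiag n) : Fin n → ℝ :=
  blockRowSum (diagConj X A)

/-- `c̃^Y(A) = c̃(Y⁻¹ A Y)`. -/
noncomputable def wBlockCol {n : ℕ} (A : Matrix (Fin n) (Fin n) ℂ) (Y : PosDiag n) : Fin n → ℝ :=
  blockColSum (diagConj Y A)

/-- The radii of the disks, types `1, …, 4`, in terms of the values `g` of the row function and
`h` of the column function. Powers are real powers, with `0 ^ 0 = 1`. -/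
noncomputable def diskRadius {n : ℕ} (k : ℕ) (g h : Fin n → ℝ) (α : ℝ) (i : Fin n) : ℝ :=
  match k with
  | 1 => g i
  | 2 => h i
  | 3 => g i ^ α * h i ^ (1 - α)
  | 4 => α * g i + (1 - α) * h i
  | _ => 0

/-- The right-hand sides of the ovals, types `5, …, 31`, in terms of the values `g` of the row
function and `h` of the column function. Powers are real powers, with `0 ^ 0 = 1`. -/
noncomputable def ovalRadius {n : ℕ} (k : ℕ) (g h : Fin n → ℝ) (α β : ℝ) (i j : Fin n) : ℝ :=
  match k with
  | 5 => g i * g j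
  | 6 => h i * h j
  | 7 => g i * h j
  | 8 => (g i * g j) ^ α * (h i * h j) ^ (1 - α)
  | 9 => (g i * h j) ^ α * (g j * h i) ^ (1 - α)
  | 10 => α * (g i * g j) + (1 - α) * (h i * h j)
  | 11 => α * (g i * h j) + (1 - α) * (g j * h i)
  | 12 => (α * g i + (1 - α) * h i) * (α * g j + (1 - α) * h j)
  | 13 => (α * g i + (1 - α) * h i) * (α * h j + (1 - α) * g j)
  | 14 => (α * g i + (1 - α) * h j) * (α * g j + (1 - α) * h i)
  | 15 => (α * g i + (1 - α) * g j) * (α * h j + (1 - α) * h i)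
  | 16 => g i ^ α * g j ^ (1 - α)
  | 17 => h i ^ α * h j ^ (1 - α)
  | 18 => g i ^ α * h j ^ (1 - α)
  | 19 => α * g i + (1 - α) * g j
  | 20 => α * h i + (1 - α) * h j
  | 21 => α * g i + (1 - α) * h j
  | 22 => (g i ^ β * h i ^ (1 - β)) ^ α * (g j ^ β * h j ^ (1 - β)) ^ (1 - α)
  | 23 => (g i ^ β * h i ^ (1 - β)) ^ α * (h j ^ β * g j ^ (1 - β)) ^ (1 - α)
  | 24 => β * (g i ^ α * g j ^ (1 - α)) + (1 - β) * (h i ^ α * h j ^ (1 - α))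
  | 25 => β * (g i ^ α * h j ^ (1 - α)) + (1 - β) * (h i ^ α * g j ^ (1 - α))
  | 26 => α * (g i ^ β * h i ^ (1 - β)) + (1 - α) * (g j ^ β * h j ^ (1 - β))
  | 27 => α * (g i ^ β * h i ^ (1 - β)) + (1 - α) * (h j ^ β * g j ^ (1 - β))
  | 28 => (β * g i + (1 - β) * h i) ^ α * (β * g j + (1 - β) * h j) ^ (1 - α)
  | 29 => (β * g i + (1 - β) * h i) ^ α * (β * h j + (1 - β) * g j) ^ (1 - α)
  | 30 => (α * g i + (1 - α) * g j) ^ β * (α * h i + (1 - α) * h j) ^ (1 - β)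
  | 31 => (α * g i + (1 - α) * h j) ^ β * (α * h i + (1 - α) * g j) ^ (1 - β)
  | _ => 0

/-- The `i`-th disk of type `k`, for `k = 1, …, 4`. -/
def diskSet {n : ℕ} (A : Matrix (Fin n) (Fin n) ℂ) (k : ℕ) (g h : Fin n → ℝ) (α : ℝ)
    (i : Fin n) : Set ℂ :=
  {z | ‖z - A i i‖ ≤ diskRadius k g h α i}

/-- The `(i, j)`-th oval of type `k`: an oval of Cassini for `k = 5, …, 15`, and a set with
weighted powers for `k = 16, …, 31`. -/
def ovalSet {n : ℕ} (A : Matrix (Fin n) (Fin n) ℂ) (k : ℕ) (g h : Fin n → ℝ) (α β : ℝ)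
    (i j : Fin n) : Set ℂ :=
  if k ≤ 15 then {z | ‖z - A i i‖ * ‖z - A j j‖ ≤ ovalRadius k g h α β i j}
  else {z | ‖z - A i i‖ ^ α * ‖z - A j j‖ ^ (1 - α) ≤ ovalRadius k g h α β i j}

/-- The set of type `k`, `1 ≤ k ≤ 31`: the union of the disks over `i`, or of the ovals over
`i ≠ j`. -/
def typeSet {n : ℕ} (A : Matrix (Fin n) (Fin n) ℂ) (k : ℕ) (g h : Fin n → ℝ) (α β : ℝ) :
    Set ℂ :=
  if k ≤ 4 then ⋃ i : Fin n, diskSet A k g h α i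
  else ⋃ (i : Fin n) (j : Fin n) (_ : i ≠ j), ovalSet A k g h α β i j

/-- The minimal set of type `k` for a weighted row function `R` and a weighted column
function `C`: the intersection over `X`, `Y` and `α, β ∈ [0, 1]`. Types that do not involve
some of the parameters do not depend on them, so that intersecting over these as well
changes nothing. -/
def minSet {n : ℕ} (A : Matrix (Fin n) (Fin n) ℂ) (R C : PosDiag n → Fin n → ℝ) (k : ℕ) :
    Set ℂ :=
  ⋂ (X : PosDiag n) (Y : PosDiag n) (α ∈ Set.Icc (0 : ℝ) 1) (β ∈ Set.Icc (0 : ℝ) 1),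
    typeSet A k (R X) (C Y) α β

/-- Varga's minimal Geršgorin set. -/
def minGersgorin {n : ℕ} (A : Matrix (Fin n) (Fin n) ℂ) : Set ℂ :=
  ⋂ X : PosDiag n, ⋃ i : Fin n, {z | ‖z - A i i‖ ≤ wRow A X i}

/-! All types follow from one condition on `z`: for every positive weight `X`, some `i` satisfies
`‖z - A i i‖ ≤ R X i`, that is, `z` lies in the minimal Geršgorin set for `R`. By a separation
argument (`exists_subinvariant`), this condition yields a nonzero nonnegative vector subinvariant
for the transposed matrix of off-diagonal moduli. Ostrowski's Hölder argument (`exists_le_mixedSum`)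
turns this vector into a disk whose radius is a geometric mean of row and column sums with
independent weights. Rescaling one coordinate of both weights upgrades disks to Cassini ovals
(`exists_mul_le_mixedSum_mul`). Recombining two Cassini pairs and applying the inequality of
arithmetic and geometric means then gives all the radii.

Eigenvalues satisfy the condition, even with sums restricted to blocks, because an eigenvector can
be cut down to a final strongly connected component of its support. Conversely, types 18 and 22 at
`α = β = 1` are Geršgorin disks, so each of their minimal sets already forces the condition, and
with it all the other types. -/

/-- The weighted row sums `(∑ j, P i j * x j) / x i` of a real matrix. -/
noncomputable def scaledRowSum {ι : Type*} [Fintype ι] (P : ι → ι → ℝ) (x : ι → ℝ) (i : ι) : ℝ :=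
  (∑ j, P i j * x j) / x i

/-- The weighted geometric mean of the weighted row sums of `P` and of its transpose. -/
noncomputable def mixedSum {ι : Type*} [Fintype ι] (P : ι → ι → ℝ) (x y : ι → ℝ) (β : ℝ)
    (i : ι) : ℝ :=
  scaledRowSum P x i ^ β * scaledRowSum (fun i j => P j i) y i ^ (1 - β)

/-- Nonnegativity on the open orthant extends to its closure, here at a basis vector. -/
theorem LinearMap.nonneg_single_of_forall_pos {ι : Type*} [DecidableEq ι]
    (L : (ι → ℝ) →ₗ[ℝ] ℝ)
    (h : ∀ x : ι → ℝ, (∀ i, 0 < x i) → 0 ≤ L x) (i : ι) : 0 ≤ L (Pi.single i 1) := by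
  refine le_of_forall_pos_le_add fun ε hε => ?_
  have h1 := h (fun _ => 1) fun _ => one_pos
  set u := L (fun _ => 1) with hu
  -- Adding this multiple of the all-ones vector makes the basis vector positive and raises `L` by
  -- at most `ε`.
  have hδ : 0 < ε / (u + 1) := by positivity
  have h2 := h (Pi.single i 1 + (ε / (u + 1)) • fun _ => 1) fun j => by
    have : (0 : ℝ) ≤ Pi.single (M := fun _ => ℝ) i 1 j := by
      by_cases hj : j = i
      · subst hj; simp
      · simp [hj]
    simp only [Pi.add_apply, Pi.smul_apply, smul_eq_mul, mul_one]
    linarith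
  rw [map_add, map_smul, ← hu, smul_eq_mul] at h2
  have h3 : ε / (u + 1) * u ≤ ε := by
    rw [div_mul_eq_mul_div, div_le_iff₀ (by positivity)]
    nlinarith
  linarith

/-! ### Weighted row and column sums of nonnegative matrices -/

section

variable {ι : Type*} [Fintype ι] {P : ι → ι → ℝ} {x y d w : ι → ℝ} {β : ℝ}

theorem scaledRowSum_nonneg (hP : ∀ i j, 0 ≤ P i j) (hx : ∀ i, 0 < x i) (i : ι) :
    0 ≤ scaledRowSum P x i :=
  div_nonneg (Finset.sum_nonneg fun j _ => mul_nonneg (hP i j) (hx j).le) (hx i).le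

theorem mixedSum_nonneg (hP : ∀ i j, 0 ≤ P i j) (hx : ∀ i, 0 < x i) (hy : ∀ i, 0 < y i) (i : ι) :
    0 ≤ mixedSum P x y β i :=
  mul_nonneg (Real.rpow_nonneg (scaledRowSum_nonneg hP hx i) _)
    (Real.rpow_nonneg (scaledRowSum_nonneg (fun i j => hP j i) hy i) _)

/-- The index maximizing `w i / x i` works, as in Geršgorin's argument. -/
theorem exists_le_scaledRowSum (hP : ∀ i j, 0 ≤ P i j) (hx : ∀ i, 0 < x i)
    (hw : ∀ i, 0 ≤ w i) (hw0 : ∃ i, w i ≠ 0) (h : ∀ i, d i * w i ≤ ∑ j, P i j * w j) :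
    ∃ i, d i ≤ scaledRowSum P x i := by
  obtain ⟨i₀, hi₀⟩ := hw0
  obtain ⟨i, -, hi⟩ := Finset.exists_max_image Finset.univ (fun i => w i / x i) ⟨i₀, Finset.mem_univ _⟩
  have hpos : 0 < w i / x i :=
    (div_pos ((hw i₀).lt_of_ne' hi₀) (hx i₀)).trans_le (hi i₀ (Finset.mem_univ _))
  have hwi : 0 < w i := by
    have := mul_pos hpos (hx i)
    rwa [div_mul_cancel₀ _ (hx i).ne'] at this
  refine ⟨i, ?_⟩
  rw [scaledRowSum, le_div_iff₀ (hx i)]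
  have h1 : ∑ j, P i j * w j ≤ (∑ j, P i j * x j) * (w i / x i) := by
    rw [Finset.sum_mul]
    refine Finset.sum_le_sum fun j _ => ?_
    rw [mul_assoc]
    refine mul_le_mul_of_nonneg_left ?_ (hP i j)
    have := hi j (Finset.mem_univ _)
    rwa [div_le_iff₀ (hx j), mul_comm] at this
  have h2 := (h i).trans h1
  rw [← mul_div_assoc, le_div_iff₀ (hx i)] at h2
  nlinarith

/-- Ostrowski's theorem on mixed row and column sums, with independent weights, for a nonnegative
subinvariant vector. -/
theorem exists_le_mixedSum (hP : ∀ i j, 0 ≤ P i j) (hx : ∀ i, 0 < x i) (hy : ∀ i, 0 < y i)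
    (hβ : β ∈ Set.Icc (0 : ℝ) 1)
    (hw : ∀ i, 0 ≤ w i) (hw0 : ∃ i, w i ≠ 0) (h : ∀ i, d i * w i ≤ ∑ j, P i j * w j) :
    ∃ i, d i ≤ mixedSum P x y β i := by
  -- The Hölder exponent `1 / (1 - β)` degenerates at `β = 1`, where only row sums remain.
  rcases hβ.2.eq_or_lt with rfl | hβ1
  · simpa [mixedSum] using exists_le_scaledRowSum hP hx hw hw0 h
  by_contra! hlt
  set p : ℝ := (1 - β)⁻¹ with hp
  have hβ' : 0 < 1 - β := by linarith
  have hp1 : 1 ≤ p := (one_le_inv₀ hβ').2 (by linarith [hβ.1])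
  have hp0 : 0 < p := by linarith
  have hpinv : p⁻¹ = 1 - β := inv_inv _
  set r := scaledRowSum P x with hr
  set c := scaledRowSum (fun i j => P j i) y with hc
  set f : ι → ℝ := fun i => w i / x i with hf
  have hf0 : ∀ i, 0 ≤ f i := fun i => div_nonneg (hw i) (hx i).le
  have hr0 : ∀ i, 0 ≤ r i := scaledRowSum_nonneg hP hx
  have hc0 : ∀ i, 0 ≤ c i := scaledRowSum_nonneg (fun i j => hP j i) hy
  set S : ι → ℝ := fun i => ∑ j, P i j * x j / x i * f j ^ p with hS
  have hq0 : ∀ i j, 0 ≤ P i j * x j / x i := fun i j =>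
    div_nonneg (mul_nonneg (hP i j) (hx j).le) (hx i).le
  have hS0 : ∀ i, 0 ≤ S i := fun i =>
    Finset.sum_nonneg fun j _ => mul_nonneg (hq0 i j) (Real.rpow_nonneg (hf0 j) _)
  -- Hölder's inequality with weights `P i j * x j / x i`, whose total over `j` is `r i`.
  have hholder : ∀ i, d i * f i ≤ r i ^ β * S i ^ (1 - β) := by
    intro i
    have h1 := Real.inner_le_weight_mul_Lp_of_nonneg Finset.univ hp1
      (fun j => P i j * x j / x i) f (hq0 i) hf0
    rw [hpinv, sub_sub_cancel, ← Finset.sum_div] at h1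
    refine le_trans ?_ h1
    calc d i * f i = d i * w i / x i := by rw [hf, mul_div_assoc]
      _ ≤ (∑ j, P i j * w j) / x i := div_le_div_of_nonneg_right (h i) (hx i).le
      _ = ∑ j, P i j * x j / x i * f j := by
        rw [Finset.sum_div]
        refine Finset.sum_congr rfl fun j _ => ?_
        have := (hx j).ne'
        simp only [hf]
        field_simp
  have hstrict : ∀ i, 0 < f i → c i * f i ^ p < S i := by
    intro i hi
    have h1 : r i ^ β * c i ^ (1 - β) * f i < r i ^ β * S i ^ (1 - β) :=
      (mul_lt_mul_of_pos_right (hlt i) hi).trans_le (hholder i)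
    rw [mul_assoc] at h1
    have h2 := lt_of_mul_lt_mul_left h1 (Real.rpow_nonneg (hr0 i) _)
    have h3 := Real.rpow_lt_rpow (by have := Real.rpow_nonneg (hc0 i) (1 - β); positivity) h2 hp0
    rwa [Real.mul_rpow (Real.rpow_nonneg (hc0 i) _) hi.le, ← Real.rpow_mul (hc0 i),
      ← Real.rpow_mul (hS0 i), hp, mul_inv_cancel₀ hβ'.ne', Real.rpow_one, Real.rpow_one,
      ← hp] at h3
  have hle : ∀ i, c i * f i ^ p ≤ S i := by
    intro i
    rcases (hf0 i).eq_or_lt with h0 | h0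
    · rw [← h0, Real.zero_rpow hp0.ne', mul_zero]
      exact hS0 i
    · exact (hstrict i h0).le
  obtain ⟨i₀, hi₀⟩ := hw0
  -- Weighted by `x i * y i`, both sides become the same double sum up to exchanging the indices, so
  -- strict inequality is impossible.
  have hlt' : ∑ i, c i * f i ^ p * (x i * y i) < ∑ i, S i * (x i * y i) := by
    refine Finset.sum_lt_sum
      (fun i _ => mul_le_mul_of_nonneg_right (hle i) (mul_pos (hx i) (hy i)).le)
      ⟨i₀, Finset.mem_univ _, mul_lt_mul_of_pos_right (hstrict i₀ ?_) (mul_pos (hx i₀) (hy i₀))⟩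
    exact div_pos ((hw i₀).lt_of_ne' hi₀) (hx i₀)
  refine hlt'.ne ?_
  have e1 : ∀ i, c i * f i ^ p * (x i * y i) = ∑ j, P j i * y j * x i * f i ^ p := by
    intro i
    have := (hy i).ne'
    rw [hc, scaledRowSum, ← Finset.sum_mul, ← Finset.sum_mul]
    field_simp
  have e2 : ∀ i, S i * (x i * y i) = ∑ j, P i j * y i * x j * f j ^ p := by
    intro i
    rw [hS, Finset.sum_mul]
    refine Finset.sum_congr rfl fun j _ => ?_
    have := (hx i).ne'
    field_simp
  rw [Finset.sum_congr rfl fun i _ => e1 i, Finset.sum_congr rfl fun i _ => e2 i,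
    Finset.sum_comm]

/-- Theorem of the alternative: if no positive vector makes `diag d - P` strictly diagonally
dominant, then the transpose of `P` has a nonnegative subinvariant vector. -/
theorem exists_subinvariant (h : ∀ x : ι → ℝ, (∀ i, 0 < x i) → ∃ i, d i ≤ scaledRowSum P x i) :
    ∃ v : ι → ℝ, (∀ i, 0 ≤ v i) ∧ (∃ i, v i ≠ 0) ∧ ∀ i, d i * v i ≤ ∑ j, P j i * v j := by
  classical
  let M : (ι → ℝ) →ₗ[ℝ] (ι → ℝ) := Matrix.toLin' (Matrix.diagonal d - Matrix.of P)
  have hM : ∀ x i, M x i = d i * x i - ∑ j, P i j * x j := by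
    intro x i
    rw [Matrix.toLin'_apply, Matrix.sub_mulVec, Pi.sub_apply, Matrix.mulVec_diagonal]
    rfl
  let O : Set (ι → ℝ) := Set.univ.pi fun _ => Set.Ioi 0
  have hO : ∀ x, x ∈ O ↔ ∀ i, 0 < x i := fun x => by simp [O]
  have hOc : Convex ℝ O := convex_pi fun _ _ => convex_Ioi 0
  have hOo : IsOpen O := isOpen_set_pi Set.finite_univ fun _ _ => isOpen_Ioi
  -- A positive `x` with `(diag d - P) x` positive would contradict `h`, so the open orthant and its
  -- image can be separated.
  have hdisj : Disjoint O (M '' O) := by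
    rw [Set.disjoint_left]
    rintro _ ha ⟨x, hx, rfl⟩
    rw [hO] at ha hx
    obtain ⟨i, hi⟩ := h x hx
    rw [scaledRowSum, le_div_iff₀ (hx i)] at hi
    have := ha i
    rw [hM] at this
    linarith
  obtain ⟨f, u, hfO, hfM⟩ := geometric_hahn_banach_open hOc hOo (hOc.linear_image M) hdisj
  have hsmul : ∀ x ∈ O, ∀ t : ℝ, 0 < t → t • x ∈ O := by
    intro x hx t ht
    rw [hO] at hx ⊢
    exact fun i => mul_pos ht (hx i)
  have hone : (fun _ => 1 : ι → ℝ) ∈ O := by simp [hO]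
  -- Both separated sets are cones, so the separating bound can be replaced by zero.
  have key : ∀ a s : ℝ, (∀ t : ℝ, 0 < t → t * a ≤ s) → a ≤ 0 := by
    intro a s hs
    by_contra! ha
    have h1 := hs ((|s| + 1) / a) (by positivity)
    rw [div_mul_cancel₀ _ ha.ne'] at h1
    linarith [le_abs_self s]
  have hf1 : ∀ x ∈ O, f x ≤ 0 := fun x hx => key _ u fun t ht => by
    simpa using (hfO _ (hsmul x hx t ht)).le
  have hf2 : ∀ x ∈ O, 0 ≤ f (M x) := fun x hx => by
    have := key (-f (M x)) (-u) fun t ht => by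
      have := hfM _ (Set.mem_image_of_mem M (hsmul x hx t ht))
      rw [map_smul, map_smul, smul_eq_mul] at this
      linarith
    linarith
  have hrep : ∀ a, f a = ∑ i, f (Pi.single i 1) * a i := by
    intro a
    conv_lhs => rw [pi_eq_sum_univ' a]
    simp only [map_sum, map_smul, smul_eq_mul]
    refine Finset.sum_congr rfl fun i _ => ?_
    rw [mul_comm]
  refine ⟨fun i => -f (Pi.single i 1), fun i => ?_, ?_, fun i => ?_⟩
  · exact LinearMap.nonneg_single_of_forall_pos (-f.toLinearMap)
      (fun x hx => by simpa using hf1 x ((hO x).2 hx)) i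
  -- The zero functional cannot separate strictly.
  · by_contra! hz
    have hz' : ∀ a, f a = 0 := fun a => by
      rw [hrep]
      exact Finset.sum_eq_zero fun i _ => by rw [neg_eq_zero.1 (hz i), zero_mul]
    have h1 := hfO _ hone
    have h2 := hfM _ (Set.mem_image_of_mem M hone)
    rw [hz'] at h1 h2
    linarith
  -- Evaluating `f ∘ M` at a basis vector reads off one column of `diag d - P`.
  · have h1 := LinearMap.nonneg_single_of_forall_pos (f.toLinearMap ∘ₗ M)
      (fun x hx => hf2 x ((hO x).2 hx)) i
    have h2 : f (M (Pi.single i 1)) =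
        f (Pi.single i 1) * d i - ∑ j, f (Pi.single j 1) * P j i := by
      rw [hrep]
      simp only [hM, mul_sub, Finset.sum_sub_distrib]
      simp [Pi.single_apply]
    have h3 : 0 ≤ f (M (Pi.single i 1)) := h1
    simp only [mul_neg, Finset.sum_neg_distrib]
    have h4 : ∑ j, P j i * f (Pi.single j 1) = ∑ j, f (Pi.single j 1) * P j i :=
      Finset.sum_congr rfl fun j _ => mul_comm _ _
    rw [h4]
    linarith

/-- The subinvariant vector belongs to the transpose, so Ostrowski's bound is used with rows and
columns, `x` and `y`, `β` and `1 - β` exchanged. -/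
theorem exists_le_mixedSum_of_forall (hP : ∀ i j, 0 ≤ P i j)
    (h : ∀ x : ι → ℝ, (∀ i, 0 < x i) → ∃ i, d i ≤ scaledRowSum P x i)
    (hx : ∀ i, 0 < x i) (hy : ∀ i, 0 < y i) (hβ : β ∈ Set.Icc (0 : ℝ) 1) :
    ∃ i, d i ≤ mixedSum P x y β i := by
  obtain ⟨v, hv, hv0, hvd⟩ := exists_subinvariant h
  obtain ⟨i, hi⟩ := exists_le_mixedSum (β := 1 - β) (fun i j => hP j i) hy hx
    ⟨by linarith [hβ.2], by linarith [hβ.1]⟩ hv hv0 hvd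
  exact ⟨i, by rwa [mixedSum, sub_sub_cancel, mul_comm] at hi⟩

/-- The zero diagonal keeps `x i` out of the numerator of row `i`; only the denominator scales. -/
theorem scaledRowSum_update_self [DecidableEq ι] {i : ι} (hPi : P i i = 0) (t : ℝ) :
    scaledRowSum P (Function.update x i (t * x i)) i = t⁻¹ * scaledRowSum P x i := by
  have : ∑ j, P i j * Function.update x i (t * x i) j = ∑ j, P i j * x j := by
    refine Finset.sum_congr rfl fun j _ => ?_
    by_cases hj : j = i
    · subst hj; simp [hPi]
    · simp [hj]
  rw [scaledRowSum, this, Function.update_self, scaledRowSum, div_eq_mul_inv, div_eq_mul_inv,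
    mul_inv]
  ring

theorem scaledRowSum_update_le [DecidableEq ι] {i j : ι} (hP : ∀ i j, 0 ≤ P i j)
    (hx : ∀ i, 0 < x i) (hij : j ≠ i) {t : ℝ} (ht : 1 ≤ t) :
    scaledRowSum P (Function.update x i (t * x i)) j ≤ t * scaledRowSum P x j := by
  rw [scaledRowSum, Function.update_of_ne hij, scaledRowSum, ← mul_div_assoc, Finset.mul_sum]
  refine div_le_div_of_nonneg_right (Finset.sum_le_sum fun k _ => ?_) (hx j).le
  rw [mul_left_comm]
  refine mul_le_mul_of_nonneg_left ?_ (hP j k)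
  by_cases hk : k = i
  · subst hk; simp
  · simp only [Function.update_of_ne hk]
    nlinarith [hx k]

theorem mul_rpow_mul_mul_rpow_one_sub {t a b : ℝ} (ht : 0 < t) (ha : 0 ≤ a) (hb : 0 ≤ b) :
    (t * a) ^ β * (t * b) ^ (1 - β) = t * (a ^ β * b ^ (1 - β)) := by
  rw [Real.mul_rpow ht.le ha, Real.mul_rpow ht.le hb, mul_mul_mul_comm, ← Real.rpow_add ht,
    add_sub_cancel, Real.rpow_one]

/-- The passage from disks to ovals of Cassini for mixed row and column sums. -/
theorem exists_mul_le_mixedSum_mul [Nontrivial ι] (hP : ∀ i j, 0 ≤ P i j) (hP0 : ∀ i, P i i = 0)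
    (hd : ∀ i, 0 ≤ d i) (h : ∀ x : ι → ℝ, (∀ i, 0 < x i) → ∃ i, d i ≤ scaledRowSum P x i)
    (hx : ∀ i, 0 < x i) (hy : ∀ i, 0 < y i) (hβ : β ∈ Set.Icc (0 : ℝ) 1) :
    ∃ i j, i ≠ j ∧ d i * d j ≤ mixedSum P x y β i * mixedSum P x y β j := by
  classical
  by_contra! hlt
  set s := mixedSum P x y β with hs
  have hs0 : ∀ i, 0 ≤ s i := mixedSum_nonneg hP hx hy
  have hdpos : ∀ i, 0 < d i := fun i => by
    obtain ⟨j, hj⟩ := exists_ne i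
    refine (hd i).lt_of_ne fun h0 => ?_
    have := hlt i j hj.symm
    rw [← h0, zero_mul] at this
    exact this.not_ge (mul_nonneg (hs0 i) (hs0 j))
  obtain ⟨i, hi⟩ := exists_le_mixedSum_of_forall hP h hx hy hβ
  -- A `t` slightly above `s i / d i` is sought: large enough to exclude index `i` after rescaling,
  -- small enough to keep `t * s j < d j` elsewhere.
  have hev : ∀ᶠ t in nhdsWithin (s i / d i) (Set.Ioi (s i / d i)), ∀ j, j ≠ i → t * s j < d j := by
    refine Filter.Eventually.filter_mono nhdsWithin_le_nhds (Filter.eventually_all.2 fun j => ?_)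
    by_cases hj : j = i
    · exact Filter.Eventually.of_forall fun t h => absurd hj h
    have hcont : ContinuousAt (fun t => t * s j) (s i / d i) := by fun_prop
    have hlt' : s i / d i * s j < d j := by
      rw [div_mul_eq_mul_div, div_lt_iff₀ (hdpos i), mul_comm (d j)]
      exact hlt i j (Ne.symm hj)
    exact (hcont.eventually_lt_const hlt').mono fun t ht _ => ht
  obtain ⟨t, htj, ht⟩ := (hev.and self_mem_nhdsWithin).exists
  have ht1 : 1 ≤ t := ((one_le_div (hdpos i)).2 hi).trans (le_of_lt ht)
  have ht0 : 0 < t := by linarith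
  have hupd : ∀ x : ι → ℝ, (∀ i, 0 < x i) → ∀ k, 0 < Function.update x i (t * x i) k := by
    intro x hx k
    by_cases hk : k = i
    · subst hk; simpa using mul_pos ht0 (hx k)
    · simpa [hk] using hx k
  -- With coordinate `i` of both weights multiplied by `t`, the mixed sum at `i` becomes `s i / t <
  -- d i`, and the others grow at most to `t * s j < d j`: no index is left.
  obtain ⟨j, hj⟩ := exists_le_mixedSum_of_forall hP h (hupd x hx) (hupd y hy) hβ
  have hr0 := scaledRowSum_nonneg hP hx
  have hc0 := scaledRowSum_nonneg (fun i j => hP j i) hy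
  by_cases hji : j = i
  · subst hji
    rw [mixedSum, scaledRowSum_update_self (hP0 j),
      scaledRowSum_update_self (P := fun i j => P j i) (hP0 j),
      mul_rpow_mul_mul_rpow_one_sub (inv_pos.2 ht0) (hr0 j) (hc0 j), ← mixedSum, ← hs,
      inv_mul_eq_div, le_div_iff₀ ht0] at hj
    replace ht : s j / d j < t := ht
    rw [div_lt_iff₀ (hdpos j)] at ht
    linarith
  · refine (htj j hji).not_ge (hj.trans ?_)
    rw [hs, mixedSum, mixedSum, ← mul_rpow_mul_mul_rpow_one_sub ht0 (hr0 j) (hc0 j)]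
    have hβ' : 0 ≤ 1 - β := by linarith [hβ.2]
    refine mul_le_mul
      (Real.rpow_le_rpow (scaledRowSum_nonneg hP (hupd x hx) j)
        (scaledRowSum_update_le hP hx hji ht1) hβ.1)
      (Real.rpow_le_rpow (scaledRowSum_nonneg (fun i j => hP j i) (hupd y hy) j)
        (scaledRowSum_update_le (fun i j => hP j i) hy hji ht1) hβ')
      (Real.rpow_nonneg (scaledRowSum_nonneg (fun i j => hP j i) (hupd y hy) j) _)
      (Real.rpow_nonneg (mul_nonneg ht0.le (hr0 j)) _)

end

/-! ### Combining Cassini pairs, and weighted means -/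

section

variable {ι : Type*} {d s t : ι → ℝ} {α : ℝ}

/-- Two pairs of distinct indices can be matched crosswise without a coincidence: if one matching
has one, the other has none. -/
theorem exists_paired (hs : ∃ i j, i ≠ j ∧ d i * d j ≤ s i * s j)
    (ht : ∃ i j, i ≠ j ∧ d i * d j ≤ t i * t j) :
    ∃ i j k l, i ≠ j ∧ k ≠ l ∧ d i * d k ≤ s i * s k ∧ d j * d l ≤ t j * t l := by
  obtain ⟨a, b, hab, hs⟩ := hs
  obtain ⟨e, f, hef, ht⟩ := ht
  by_cases h : a ≠ e ∧ b ≠ f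
  · exact ⟨a, e, b, f, h.1, h.2, hs, ht⟩
  · refine ⟨a, f, b, e, ?_, ?_, hs, by rwa [mul_comm, mul_comm (t f)]⟩ <;> grind

theorem exists_mul_le_mul (hs0 : ∀ i, 0 ≤ s i) (ht0 : ∀ i, 0 ≤ t i) (hd : ∀ i, 0 ≤ d i)
    (hs : ∃ i j, i ≠ j ∧ d i * d j ≤ s i * s j) (ht : ∃ i j, i ≠ j ∧ d i * d j ≤ t i * t j) :
    ∃ i j, i ≠ j ∧ d i * d j ≤ s i * t j := by
  obtain ⟨i, j, k, l, hij, hkl, h1, h2⟩ := exists_paired hs ht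
  by_contra! hlt
  -- The product over the two matched pairs regroups into the product of the two given inequalities.
  have h3 := mul_lt_mul'' (hlt i j hij) (hlt k l hkl) (mul_nonneg (hs0 i) (ht0 j))
    (mul_nonneg (hs0 k) (ht0 l))
  have h4 := mul_le_mul h1 h2 (mul_nonneg (hd j) (hd l)) (mul_nonneg (hs0 i) (hs0 k))
  linarith

theorem exists_rpow_mul_rpow_le (hs0 : ∀ i, 0 ≤ s i) (ht0 : ∀ i, 0 ≤ t i) (hd : ∀ i, 0 ≤ d i)
    (hs : ∃ i j, i ≠ j ∧ d i * d j ≤ s i * s j) (ht : ∃ i j, i ≠ j ∧ d i * d j ≤ t i * t j)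
    (hα : α ∈ Set.Icc (0 : ℝ) 1) :
    ∃ i j, i ≠ j ∧ d i ^ α * d j ^ (1 - α) ≤ s i ^ α * t j ^ (1 - α) := by
  obtain ⟨i, j, k, l, hij, hkl, h1, h2⟩ := exists_paired hs ht
  by_contra! hlt
  have hr : ∀ {x p : ℝ}, 0 ≤ x → 0 ≤ x ^ p := fun hx => Real.rpow_nonneg hx _
  have h3 := mul_lt_mul'' (hlt i j hij) (hlt k l hkl) (mul_nonneg (hr (hs0 i)) (hr (ht0 j)))
    (mul_nonneg (hr (hs0 k)) (hr (ht0 l)))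
  have h4 := mul_le_mul (Real.rpow_le_rpow (mul_nonneg (hd i) (hd k)) h1 hα.1)
    (Real.rpow_le_rpow (mul_nonneg (hd j) (hd l)) h2 (sub_nonneg.2 hα.2))
    (hr (mul_nonneg (hd j) (hd l))) (hr (mul_nonneg (hs0 i) (hs0 k)))
  rw [Real.mul_rpow (hd i) (hd k), Real.mul_rpow (hd j) (hd l), Real.mul_rpow (hs0 i) (hs0 k),
    Real.mul_rpow (ht0 j) (ht0 l)] at h4
  linarith

theorem rpow_mul_rpow_rpow_comm {a b c e : ℝ} (ha : 0 ≤ a) (hb : 0 ≤ b) (hc : 0 ≤ c) (he : 0 ≤ e)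
    (p q r s : ℝ) :
    (a ^ p * b ^ q) ^ r * (c ^ p * e ^ q) ^ s = (a ^ r * c ^ s) ^ p * (b ^ r * e ^ s) ^ q := by
  rw [Real.mul_rpow, Real.mul_rpow, Real.mul_rpow, Real.mul_rpow]
  · simp only [← Real.rpow_mul, ha, hb, hc, he]
    rw [mul_comm r p, mul_comm s p, mul_comm r q, mul_comm s q]
    ring
  all_goals exact Real.rpow_nonneg ‹_› _

theorem mul_rpow_mul_mul_rpow {a b c e : ℝ} (ha : 0 ≤ a) (hb : 0 ≤ b) (hc : 0 ≤ c) (he : 0 ≤ e)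
    (p q : ℝ) : (a * c) ^ p * (b * e) ^ q = a ^ p * b ^ q * (c ^ p * e ^ q) := by
  rw [Real.mul_rpow ha hc, Real.mul_rpow hb he]
  ring

theorem rpow_mul_rpow_le (hα : α ∈ Set.Icc (0 : ℝ) 1) {a b : ℝ} (ha : 0 ≤ a) (hb : 0 ≤ b) :
    a ^ α * b ^ (1 - α) ≤ α * a + (1 - α) * b :=
  Real.geom_mean_le_arith_mean2_weighted hα.1 (sub_nonneg.2 hα.2) ha hb (by ring)

end

/-! ### All disks and ovals from mixed Cassini ovals -/

theorem exists_mem_diskSet_and_ovalSet {n : ℕ} {A : Matrix (Fin n) (Fin n) ℂ} {z : ℂ}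
    {g h : Fin n → ℝ} (hg : ∀ i, 0 ≤ g i) (hh : ∀ i, 0 ≤ h i)
    (H : ∀ β ∈ Set.Icc (0 : ℝ) 1, ∃ i j, i ≠ j ∧ ‖z - A i i‖ * ‖z - A j j‖ ≤
      g i ^ β * h i ^ (1 - β) * (g j ^ β * h j ^ (1 - β)))
    {α β : ℝ} (hα : α ∈ Set.Icc (0 : ℝ) 1) (hβ : β ∈ Set.Icc (0 : ℝ) 1) :
    (∀ k ∈ Set.Icc 1 4, ∃ i, z ∈ diskSet A k g h α i) ∧
      ∀ k ∈ Set.Icc 5 31, ∃ i j, i ≠ j ∧ z ∈ ovalSet A k g h α β i j := by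
  set d : Fin n → ℝ := fun i => ‖z - A i i‖ with hd
  have hd0 : ∀ i, 0 ≤ d i := fun i => norm_nonneg _
  have hr : ∀ {x : ℝ} (p : ℝ), 0 ≤ x → 0 ≤ x ^ p := fun p hx => Real.rpow_nonneg hx _
  have hm : ∀ (β : ℝ) i, 0 ≤ g i ^ β * h i ^ (1 - β) := fun β i =>
    mul_nonneg (hr _ (hg i)) (hr _ (hh i))
  have hm' : ∀ (β : ℝ) i, 0 ≤ h i ^ β * g i ^ (1 - β) := fun β i =>
    mul_nonneg (hr _ (hh i)) (hr _ (hg i))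
  -- Exchanging `g` and `h` amounts to replacing `β` by `1 - β`.
  have H' : ∀ β ∈ Set.Icc (0 : ℝ) 1, ∃ i j, i ≠ j ∧ d i * d j ≤
      h i ^ β * g i ^ (1 - β) * (h j ^ β * g j ^ (1 - β)) := by
    intro β hβ
    obtain ⟨i, j, hij, hle⟩ := H (1 - β) ⟨sub_nonneg.2 hβ.2, by linarith [hβ.1]⟩
    refine ⟨i, j, hij, hle.trans_eq ?_⟩
    rw [sub_sub_cancel]
    ring
  have Hg : ∃ i j, i ≠ j ∧ d i * d j ≤ g i * g j := by simpa using H 1 (by simp)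
  have Hh : ∃ i j, i ≠ j ∧ d i * d j ≤ h i * h j := by simpa using H 0 (by simp)
  have disk : ∀ {s : Fin n → ℝ}, (∀ i, 0 ≤ s i) →
      (∃ i j, i ≠ j ∧ d i * d j ≤ s i * s j) → ∃ i, d i ≤ s i := by
    rintro s hs ⟨i, j, -, hle⟩
    by_contra! hlt
    exact (mul_lt_mul'' (hlt i) (hlt j) (hs i) (hs j)).not_ge hle
  have hα' : 0 ≤ 1 - α := sub_nonneg.2 hα.2
  have hβ' : 0 ≤ 1 - β := sub_nonneg.2 hβ.2
  have am : ∀ {a b : ℝ}, 0 ≤ a → 0 ≤ b → 0 ≤ α * a + (1 - α) * b := fun ha hb =>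
    add_nonneg (mul_nonneg hα.1 ha) (mul_nonneg hα' hb)
  have bm : ∀ {a b : ℝ}, 0 ≤ a → 0 ≤ b → 0 ≤ β * a + (1 - β) * b := fun ha hb =>
    add_nonneg (mul_nonneg hβ.1 ha) (mul_nonneg hβ' hb)
  have gm : ∀ {a b : ℝ} (p q : ℝ), 0 ≤ a → 0 ≤ b → 0 ≤ a ^ p * b ^ q := fun p q ha hb =>
    mul_nonneg (hr _ ha) (hr _ hb)
  -- `EA` and `EB` bound plain products, `EC` and `ED` weighted ones; in `EB` and `ED` the roles of
  -- `g` and `h` are exchanged at `j`. Types 8–15 and 22–31 follow from these by regrouping and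
  -- weakening geometric means to arithmetic ones.
  have EA := H α hα
  have EB := exists_mul_le_mul (hm α) (hm' α) hd0 (H α hα) (H' α hα)
  have EC := exists_rpow_mul_rpow_le (hm β) (hm β) hd0 (H β hβ) (H β hβ) hα
  have ED := exists_rpow_mul_rpow_le (hm β) (hm' β) hd0 (H β hβ) (H' β hβ) hα
  have Egg := exists_rpow_mul_rpow_le hg hg hd0 Hg Hg hα
  have Ehh := exists_rpow_mul_rpow_le hh hh hd0 Hh Hh hα
  have Egh := exists_rpow_mul_rpow_le hg hh hd0 Hg Hh hα
  have mono : ∀ {F G : Fin n → Fin n → ℝ} {l : Fin n → Fin n → ℝ},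
      (∃ i j, i ≠ j ∧ l i j ≤ F i j) → (∀ i j, F i j ≤ G i j) →
      ∃ i j, i ≠ j ∧ l i j ≤ G i j := fun ⟨i, j, hij, hle⟩ hFG =>
    ⟨i, j, hij, hle.trans (hFG i j)⟩
  constructor
  · rintro k ⟨hk1, hk2⟩
    interval_cases k
    · exact disk hg Hg
    · exact disk hh Hh
    · exact disk (hm α) (H α hα)
    · obtain ⟨i, hi⟩ := disk (hm α) (H α hα)
      exact ⟨i, hi.trans (rpow_mul_rpow_le hα (hg i) (hh i))⟩
  · rintro k ⟨hk1, hk2⟩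
    by_cases hk : k ≤ 15
    · suffices ∃ i j, i ≠ j ∧ d i * d j ≤ ovalRadius k g h α β i j by
        simp only [ovalSet, if_pos hk]
        exact this
      interval_cases k
      · exact Hg
      · exact Hh
      · exact exists_mul_le_mul hg hh hd0 Hg Hh
      · exact mono EA fun i j => (mul_rpow_mul_mul_rpow (hg i) (hh i) (hg j) (hh j) _ _).ge
      · refine mono EB fun i j => ?_
        simp only [ovalRadius]
        rw [mul_comm (g j), mul_rpow_mul_mul_rpow (hg i) (hh i) (hh j) (hg j)]
      · refine mono EA fun i j => ?_
        rw [← mul_rpow_mul_mul_rpow (hg i) (hh i) (hg j) (hh j)]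
        exact rpow_mul_rpow_le hα (mul_nonneg (hg i) (hg j)) (mul_nonneg (hh i) (hh j))
      · refine mono EB fun i j => ?_
        simp only [ovalRadius]
        rw [mul_comm (g j), ← mul_rpow_mul_mul_rpow (hg i) (hh i) (hh j) (hg j)]
        exact rpow_mul_rpow_le hα (mul_nonneg (hg i) (hh j)) (mul_nonneg (hh i) (hg j))
      · exact mono EA fun i j => mul_le_mul (rpow_mul_rpow_le hα (hg i) (hh i))
          (rpow_mul_rpow_le hα (hg j) (hh j)) (hm _ _) (am (hg i) (hh i))
      · exact mono EB fun i j => mul_le_mul (rpow_mul_rpow_le hα (hg i) (hh i))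
          (rpow_mul_rpow_le hα (hh j) (hg j)) (hm' _ _) (am (hg i) (hh i))
      · refine mono EA fun i j => ?_
        calc _ = g i ^ α * h j ^ (1 - α) * (g j ^ α * h i ^ (1 - α)) := by ring
          _ ≤ _ := mul_le_mul (rpow_mul_rpow_le hα (hg i) (hh j))
            (rpow_mul_rpow_le hα (hg j) (hh i)) (gm _ _ (hg j) (hh i)) (am (hg i) (hh j))
      · refine mono EB fun i j => ?_
        calc _ = g i ^ α * g j ^ (1 - α) * (h j ^ α * h i ^ (1 - α)) := by ring
          _ ≤ _ := mul_le_mul (rpow_mul_rpow_le hα (hg i) (hg j))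
            (rpow_mul_rpow_le hα (hh j) (hh i)) (gm _ _ (hh j) (hh i)) (am (hg i) (hg j))
    · suffices ∃ i j, i ≠ j ∧ d i ^ α * d j ^ (1 - α) ≤ ovalRadius k g h α β i j by
        simp only [ovalSet, if_neg hk]
        exact this
      push Not at hk
      interval_cases k
      · exact Egg
      · exact Ehh
      · exact Egh
      · exact mono Egg fun i j => rpow_mul_rpow_le hα (hg i) (hg j)
      · exact mono Ehh fun i j => rpow_mul_rpow_le hα (hh i) (hh j)
      · exact mono Egh fun i j => rpow_mul_rpow_le hα (hg i) (hh j)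
      · exact EC
      · exact ED
      · refine mono EC fun i j => ?_
        rw [rpow_mul_rpow_rpow_comm (hg i) (hh i) (hg j) (hh j)]
        exact rpow_mul_rpow_le hβ (gm _ _ (hg i) (hg j)) (gm _ _ (hh i) (hh j))
      · refine mono ED fun i j => ?_
        rw [rpow_mul_rpow_rpow_comm (hg i) (hh i) (hh j) (hg j)]
        exact rpow_mul_rpow_le hβ (gm _ _ (hg i) (hh j)) (gm _ _ (hh i) (hg j))
      · exact mono EC fun i j => rpow_mul_rpow_le hα (hm β i) (hm β j)
      · exact mono ED fun i j => rpow_mul_rpow_le hα (hm β i) (hm' β j)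
      · exact mono EC fun i j => mul_le_mul
          (Real.rpow_le_rpow (hm β i) (rpow_mul_rpow_le hβ (hg i) (hh i)) hα.1)
          (Real.rpow_le_rpow (hm β j) (rpow_mul_rpow_le hβ (hg j) (hh j)) hα')
          (hr _ (hm β j)) (hr _ (bm (hg i) (hh i)))
      · exact mono ED fun i j => mul_le_mul
          (Real.rpow_le_rpow (hm β i) (rpow_mul_rpow_le hβ (hg i) (hh i)) hα.1)
          (Real.rpow_le_rpow (hm' β j) (rpow_mul_rpow_le hβ (hh j) (hg j)) hα')
          (hr _ (hm' β j)) (hr _ (bm (hg i) (hh i)))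
      · refine mono EC fun i j => ?_
        rw [rpow_mul_rpow_rpow_comm (hg i) (hh i) (hg j) (hh j)]
        exact mul_le_mul
          (Real.rpow_le_rpow (gm _ _ (hg i) (hg j)) (rpow_mul_rpow_le hα (hg i) (hg j)) hβ.1)
          (Real.rpow_le_rpow (gm _ _ (hh i) (hh j)) (rpow_mul_rpow_le hα (hh i) (hh j)) hβ')
          (hr _ (gm _ _ (hh i) (hh j))) (hr _ (am (hg i) (hg j)))
      · refine mono ED fun i j => ?_
        rw [rpow_mul_rpow_rpow_comm (hg i) (hh i) (hh j) (hg j)]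
        exact mul_le_mul
          (Real.rpow_le_rpow (gm _ _ (hg i) (hh j)) (rpow_mul_rpow_le hα (hg i) (hh j)) hβ.1)
          (Real.rpow_le_rpow (gm _ _ (hh i) (hg j)) (rpow_mul_rpow_le hα (hh i) (hg j)) hβ')
          (hr _ (gm _ _ (hh i) (hg j))) (hr _ (am (hg i) (hh j)))

/-! ### Off-diagonal moduli and diagonal similarity -/

section

variable {n : ℕ} {A : Matrix (Fin n) (Fin n) ℂ} {z : ℂ}

open Classical in
/-- The moduli of the off-diagonal entries of `A`, restricted to a relation `S`. -/
noncomputable def offDiagNorm (A : Matrix (Fin n) (Fin n) ℂ) (S : Fin n → Fin n → Prop)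
    (i j : Fin n) : ℝ :=
  if j ≠ i ∧ S i j then ‖A i j‖ else 0

theorem offDiagNorm_nonneg (S : Fin n → Fin n → Prop) (i j : Fin n) : 0 ≤ offDiagNorm A S i j := by
  rw [offDiagNorm]
  split_ifs
  exacts [norm_nonneg _, le_rfl]

theorem offDiagNorm_self (S : Fin n → Fin n → Prop) (i : Fin n) : offDiagNorm A S i i = 0 := by
  simp [offDiagNorm]

theorem diagConj_apply (X : PosDiag n) (A : Matrix (Fin n) (Fin n) ℂ) (i j : Fin n) :
    diagConj X A i j = (X.1 i : ℂ)⁻¹ * A i j * X.1 j := by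
  simp [diagConj, Matrix.mul_diagonal, Matrix.diagonal_mul]

theorem norm_diagConj_apply (X : PosDiag n) (A : Matrix (Fin n) (Fin n) ℂ) (i j : Fin n) :
    ‖diagConj X A i j‖ = ‖A i j‖ * X.1 j / X.1 i := by
  rw [diagConj_apply, norm_mul, norm_mul, norm_inv, Complex.norm_real, Complex.norm_real,
    Real.norm_of_nonneg (X.2 i).le, Real.norm_of_nonneg (X.2 j).le]
  ring

theorem diagConj_apply_ne_zero (X : PosDiag n) (A : Matrix (Fin n) (Fin n) ℂ) (i j : Fin n) :
    diagConj X A i j ≠ 0 ↔ A i j ≠ 0 := by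
  have hi := (X.2 i).ne'
  have hj := (X.2 j).ne'
  simp [diagConj_apply, hi, hj]

theorem sameBlock_diagConj (X : PosDiag n) (A : Matrix (Fin n) (Fin n) ℂ) (i j : Fin n) :
    SameBlock (diagConj X A) i j ↔ SameBlock A i j := by
  simp only [SameBlock, diagConj_apply_ne_zero]

theorem wRow_eq (X : PosDiag n) :
    wRow A X = scaledRowSum (offDiagNorm A fun _ _ => True) X.1 := by
  ext i
  rw [wRow, delRowSum, scaledRowSum, Finset.sum_div, ← Finset.filter_ne', Finset.sum_filter]
  refine Finset.sum_congr rfl fun j _ => ?_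
  by_cases h : j = i <;> simp [offDiagNorm, norm_diagConj_apply, h]

/-- The inverse weights appear because entry `(j, i)` of the similarity carries the factor `Y i / Y
j`. As `Y` is arbitrary, this costs nothing. -/
theorem wCol_eq (Y : PosDiag n) :
    wCol A Y = scaledRowSum (fun i j => offDiagNorm A (fun _ _ => True) j i) (Y.1)⁻¹ := by
  ext i
  rw [wCol, delColSum, scaledRowSum, Finset.sum_div, ← Finset.filter_ne', Finset.sum_filter]
  refine Finset.sum_congr rfl fun j _ => ?_
  by_cases h : j ≠ i
  · rw [offDiagNorm, if_pos h, if_pos ⟨h.symm, trivial⟩, norm_diagConj_apply, Pi.inv_apply,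
      Pi.inv_apply, div_inv_eq_mul]
    ring
  · rw [offDiagNorm, if_neg h, if_neg fun h' => h h'.1.symm, zero_mul, zero_div]

theorem wBlockRow_eq (X : PosDiag n) :
    wBlockRow A X = scaledRowSum (offDiagNorm A (SameBlock A)) X.1 := by
  ext i
  rw [wBlockRow, blockRowSum, scaledRowSum, Finset.sum_div, ← Finset.filter_ne',
    Finset.filter_filter, Finset.sum_filter]
  refine Finset.sum_congr rfl fun j _ => ?_
  by_cases h : j ≠ i ∧ SameBlock A i j
  · rw [sameBlock_diagConj, offDiagNorm, if_pos h, if_pos h, norm_diagConj_apply]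
  · rw [sameBlock_diagConj, offDiagNorm, if_neg h, if_neg h, zero_mul, zero_div]

theorem wBlockCol_eq (Y : PosDiag n) :
    wBlockCol A Y = scaledRowSum (fun i j => offDiagNorm A (SameBlock A) j i) (Y.1)⁻¹ := by
  ext i
  rw [wBlockCol, blockColSum, scaledRowSum, Finset.sum_div, ← Finset.filter_ne',
    Finset.filter_filter, Finset.sum_filter]
  refine Finset.sum_congr rfl fun j _ => ?_
  have hc : (j ≠ i ∧ SameBlock A i j) ↔ (i ≠ j ∧ SameBlock A j i) :=
    and_congr ne_comm and_comm
  by_cases h : j ≠ i ∧ SameBlock A i j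
  · rw [sameBlock_diagConj, offDiagNorm, if_pos h, if_pos (hc.1 h), norm_diagConj_apply,
      Pi.inv_apply, Pi.inv_apply, div_inv_eq_mul]
    ring
  · rw [sameBlock_diagConj, offDiagNorm, if_neg h, if_neg (mt hc.2 h), zero_mul, zero_div]

/-! ### Eigenvectors and strongly connected components -/

theorem exists_eigenvector (hz : z ∈ spectrum ℂ A) :
    ∃ u : Fin n → ℂ, u ≠ 0 ∧ ∀ i, ∑ j, A i j * u j = z * u i := by
  rw [← Matrix.spectrum_toLin', ← Module.End.hasEigenvalue_iff_mem_spectrum] at hz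
  obtain ⟨u, hu⟩ := hz.exists_hasEigenvector
  refine ⟨u, hu.2, fun i => ?_⟩
  exact congrFun hu.apply_eq_smul i

theorem norm_sub_mul_norm_le {u : Fin n → ℂ} (hu : ∀ i, ∑ j, A i j * u j = z * u i) (i : Fin n) :
    ‖z - A i i‖ * ‖u i‖ ≤ ∑ j ∈ Finset.univ.erase i, ‖A i j‖ * ‖u j‖ := by
  have h := hu i
  rw [← Finset.add_sum_erase _ _ (Finset.mem_univ i)] at h
  have h' : (z - A i i) * u i = ∑ j ∈ Finset.univ.erase i, A i j * u j := by
    rw [sub_mul, ← h]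
    ring
  rw [← norm_mul, h']
  simpa only [norm_mul] using norm_sum_le _ fun j => A i j * u j

/-- The moduli of the part of an eigenvector supported on a final component of its support are
subinvariant within the blocks. -/
theorem exists_subinvariant_block (hz : z ∈ spectrum ℂ A) :
    ∃ w : Fin n → ℝ, (∀ i, 0 ≤ w i) ∧ (∃ i, w i ≠ 0) ∧
      ∀ i, ‖z - A i i‖ * w i ≤ ∑ j, offDiagNorm A (SameBlock A) i j * w j := by
  classical
  obtain ⟨u, hu0, hu⟩ := exists_eigenvector hz
  set reach : Fin n → Finset (Fin n) := fun i =>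
    {j | Relation.ReflTransGen (fun a b => A a b ≠ 0) i j} with hreach
  have hmem : ∀ i j, j ∈ reach i ↔ Relation.ReflTransGen (fun a b => A a b ≠ 0) i j := fun i j => by
    simp [hreach]
  obtain ⟨i₀, hi₀⟩ := Function.ne_iff.1 hu0
  -- A support index with the fewest reachable indices lies in a final component: any support index
  -- reachable from it has the same reachable set, hence leads back.
  obtain ⟨m, hm, hmin⟩ := Finset.exists_min_image {i | u i ≠ 0} (fun i => (reach i).card)
    ⟨i₀, by simpa using hi₀⟩
  simp only [Finset.mem_filter, Finset.mem_univ, true_and] at hm hmin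
  have hfinal : ∀ j, u j ≠ 0 → Relation.ReflTransGen (fun a b => A a b ≠ 0) m j →
      SameBlock A m j := by
    intro j hj hmj
    refine ⟨hmj, ?_⟩
    have hsub : reach j ⊆ reach m := fun k hk =>
      (hmem _ _).2 (hmj.trans ((hmem _ _).1 hk))
    rw [← hmem, Finset.eq_of_subset_of_card_le hsub (hmin j hj), hmem]
  have hnn : ∀ i, 0 ≤ (if SameBlock A m i then ‖u i‖ else 0) := fun i => by
    split_ifs
    exacts [norm_nonneg _, le_rfl]
  refine ⟨fun i => if SameBlock A m i then ‖u i‖ else 0, hnn, ⟨m, ?_⟩, fun i => ?_⟩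
  · have : SameBlock A m m := ⟨.refl, .refl⟩
    simpa [this] using hm
  by_cases hi : SameBlock A m i
  · simp only [if_pos hi]
    refine (norm_sub_mul_norm_le hu i).trans ?_
    rw [← Finset.filter_ne', Finset.sum_filter]
    refine Finset.sum_le_sum fun j _ => ?_
    split_ifs with hji hj hj
    · have hij : SameBlock A i j := ⟨hi.2.trans hj.1, hj.2.trans hi.1⟩
      rw [offDiagNorm, if_pos ⟨hji, hij⟩]
    -- A nonzero term leaving the block would give a support index reachable from `m`, which
    -- finality puts back in the block.
    · by_cases hA : A i j = 0
      · simp [hA]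
      by_cases huj : u j = 0
      · simp [huj]
      exact absurd (hfinal j huj (hi.1.tail hA)) hj
    · exact mul_nonneg (offDiagNorm_nonneg _ _ _) (norm_nonneg _)
    · simp
  · simp only [if_neg hi, mul_zero]
    exact Finset.sum_nonneg fun j _ => mul_nonneg (offDiagNorm_nonneg _ _ _) (hnn j)

theorem exists_le_scaledRowSum_offDiagNorm {S : Fin n → Fin n → Prop}
    (hS : ∀ i j, SameBlock A i j → S i j) (hz : z ∈ spectrum ℂ A) (X : PosDiag n) :
    ∃ i, ‖z - A i i‖ ≤ scaledRowSum (offDiagNorm A S) X.1 i := by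
  obtain ⟨w, hw, hw0, h⟩ := exists_subinvariant_block hz
  refine exists_le_scaledRowSum (offDiagNorm_nonneg S) X.2 hw hw0 fun i => (h i).trans ?_
  refine Finset.sum_le_sum fun j _ => mul_le_mul_of_nonneg_right ?_ (hw j)
  by_cases hij : j ≠ i ∧ SameBlock A i j
  · rw [offDiagNorm, offDiagNorm, if_pos hij, if_pos ⟨hij.1, hS i j hij.2⟩]
  · rw [offDiagNorm, if_neg hij]
    exact offDiagNorm_nonneg _ _ _

/-! ### Membership in the minimal sets -/

variable {R C : PosDiag n → Fin n → ℝ} {S : Fin n → Fin n → Prop}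

/-- The hypothesis concerns row disks only, so it serves both eigenvalues and points of a minimal
set. -/
theorem mem_diskSet_and_ovalSet_of_forall (hn : 2 ≤ n)
    (hR : ∀ X, R X = scaledRowSum (offDiagNorm A S) X.1)
    (hC : ∀ Y, C Y = scaledRowSum (fun i j => offDiagNorm A S j i) (Y.1)⁻¹)
    (h : ∀ X, ∃ i, ‖z - A i i‖ ≤ R X i) (X Y : PosDiag n) {α β : ℝ}
    (hα : α ∈ Set.Icc (0 : ℝ) 1) (hβ : β ∈ Set.Icc (0 : ℝ) 1) :
    (∀ k ∈ Set.Icc 1 4, ∃ i, z ∈ diskSet A k (R X) (C Y) α i) ∧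
      ∀ k ∈ Set.Icc 5 31, ∃ i j, i ≠ j ∧ z ∈ ovalSet A k (R X) (C Y) α β i j := by
  have : Nontrivial (Fin n) := Fin.nontrivial_iff_two_le.2 hn
  have hY : ∀ i, 0 < (Y.1)⁻¹ i := fun i => inv_pos.2 (Y.2 i)
  have hP := offDiagNorm_nonneg (A := A) S
  rw [hR, hC]
  refine exists_mem_diskSet_and_ovalSet (scaledRowSum_nonneg hP X.2)
    (scaledRowSum_nonneg (fun i j => hP j i) hY) (fun γ hγ => ?_) hα hβ
  exact exists_mul_le_mixedSum_mul hP (offDiagNorm_self S) (fun i => norm_nonneg (z - A i i))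
    (fun x hx => hR ⟨x, hx⟩ ▸ h ⟨x, hx⟩) X.2 hY hγ

theorem mem_typeSet_of_mem {g h : Fin n → ℝ} {α β : ℝ}
    (H : (∀ k ∈ Set.Icc 1 4, ∃ i, z ∈ diskSet A k g h α i) ∧
      ∀ k ∈ Set.Icc 5 31, ∃ i j, i ≠ j ∧ z ∈ ovalSet A k g h α β i j)
    {k : ℕ} (hk : k ∈ Set.Icc 1 31) : z ∈ typeSet A k g h α β := by
  by_cases hk4 : k ≤ 4
  · rw [typeSet, if_pos hk4]
    exact Set.mem_iUnion.2 (H.1 k ⟨hk.1, hk4⟩)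
  · rw [typeSet, if_neg hk4]
    obtain ⟨i, j, hij, hz⟩ := H.2 k ⟨by omega, hk.2⟩
    simp only [Set.mem_iUnion]
    exact ⟨i, j, hij, hz⟩

theorem minSet_subset_typeSet (X Y : PosDiag n) {α β : ℝ} (hα : α ∈ Set.Icc (0 : ℝ) 1)
    (hβ : β ∈ Set.Icc (0 : ℝ) 1) (k : ℕ) : minSet A R C k ⊆ typeSet A k (R X) (C Y) α β := by
  intro z hz
  simp only [minSet, Set.mem_iInter] at hz
  exact hz X Y α hα β hβ

theorem mem_minSet_of_forall (hn : 2 ≤ n)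
    (hR : ∀ X, R X = scaledRowSum (offDiagNorm A S) X.1)
    (hC : ∀ Y, C Y = scaledRowSum (fun i j => offDiagNorm A S j i) (Y.1)⁻¹)
    (h : ∀ X, ∃ i, ‖z - A i i‖ ≤ R X i) {k : ℕ} (hk : k ∈ Set.Icc 1 31) : z ∈ minSet A R C k := by
  simp only [minSet, Set.mem_iInter]
  exact fun X Y α hα β hβ =>
    mem_typeSet_of_mem (mem_diskSet_and_ovalSet_of_forall hn hR hC h X Y hα hβ) hk

/-- With `α = β = 1`, the ovals of types `18` and `22` are Geršgorin disks. -/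
theorem exists_le_of_mem_minSet {k : ℕ} (hk : k = 18 ∨ k = 22) (hz : z ∈ minSet A R C k)
    (X : PosDiag n) : ∃ i, ‖z - A i i‖ ≤ R X i := by
  have h1 : (1 : ℝ) ∈ Set.Icc (0 : ℝ) 1 := by simp
  have h := minSet_subset_typeSet X ⟨1, fun _ => one_pos⟩ h1 h1 k hz
  rcases hk with rfl | rfl
  all_goals
    -- All factors at `j` and all column sums have exponent `0`, hence equal `1` even when the base
    -- vanishes.
    simp [typeSet, ovalSet, ovalRadius] at h
    obtain ⟨i, -, hi⟩ := h
    exact ⟨i, hi⟩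

end

/-! ### Spectral inclusions and equality of minimal sets -/

theorem theorem5p5 (n : ℕ) (hn : 2 ≤ n) (A : Matrix (Fin n) (Fin n) ℂ) :
    -- the weighted sums `r^X`, `c^Y`
    ((∀ X Y : PosDiag n, ∀ α ∈ Set.Icc (0 : ℝ) 1, ∀ β ∈ Set.Icc (0 : ℝ) 1,
        (∀ z ∈ spectrum ℂ A,
          (∀ k ∈ Set.Icc 1 4, ∃ i, z ∈ diskSet A k (wRow A X) (wCol A Y) α i) ∧
          (∀ k ∈ Set.Icc 5 31, ∃ i j, i ≠ j ∧
            z ∈ ovalSet A k (wRow A X) (wCol A Y) α β i j)) ∧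
        (∀ k ∈ Set.Icc 1 31,
          spectrum ℂ A ⊆ minSet A (wRow A) (wCol A) k ∧
          minSet A (wRow A) (wCol A) k ⊆ typeSet A k (wRow A X) (wCol A Y) α β)) ∧
      spectrum ℂ A ⊆ (⋂ k ∈ Set.Icc 1 31, minSet A (wRow A) (wCol A) k) ∧
      (⋂ k ∈ Set.Icc 1 31, minSet A (wRow A) (wCol A) k) =
        minSet A (wRow A) (wCol A) 22 ∩ minSet A (wRow A) (wCol A) 23 ∧
      minSet A (wRow A) (wCol A) 22 ∩ minSet A (wRow A) (wCol A) 23 ⊆ minGersgorin A) ∧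
    -- the weighted sums `r̃^X`, `c̃^Y` inside the blocks of the Frobenius normal form
    ((∀ X Y : PosDiag n, ∀ α ∈ Set.Icc (0 : ℝ) 1, ∀ β ∈ Set.Icc (0 : ℝ) 1,
        (∀ z ∈ spectrum ℂ A,
          (∀ k ∈ Set.Icc 1 4, ∃ i, z ∈ diskSet A k (wBlockRow A X) (wBlockCol A Y) α i) ∧
          (∀ k ∈ Set.Icc 5 31, ∃ i j, i ≠ j ∧
            z ∈ ovalSet A k (wBlockRow A X) (wBlockCol A Y) α β i j)) ∧
        (∀ k ∈ Set.Icc 1 31,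
          spectrum ℂ A ⊆ minSet A (wBlockRow A) (wBlockCol A) k ∧
          minSet A (wBlockRow A) (wBlockCol A) k ⊆
            typeSet A k (wBlockRow A X) (wBlockCol A Y) α β)) ∧
      spectrum ℂ A ⊆ (⋂ k ∈ Set.Icc 1 31, minSet A (wBlockRow A) (wBlockCol A) k) ∧
      (⋂ k ∈ Set.Icc 1 31, minSet A (wBlockRow A) (wBlockCol A) k) =
        minSet A (wBlockRow A) (wBlockCol A) 18) := by
  have hspec : ∀ z ∈ spectrum ℂ A, ∀ X, ∃ i, ‖z - A i i‖ ≤ wRow A X i := fun z hz X => by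
    rw [wRow_eq]
    exact exists_le_scaledRowSum_offDiagNorm (fun _ _ _ => trivial) hz X
  have hspecB : ∀ z ∈ spectrum ℂ A, ∀ X, ∃ i, ‖z - A i i‖ ≤ wBlockRow A X i := fun z hz X => by
    rw [wBlockRow_eq]
    exact exists_le_scaledRowSum_offDiagNorm (fun _ _ => id) hz X
  refine ⟨⟨fun X Y α hα β hβ => ⟨fun z hz => ?_, fun k hk => ⟨fun z hz => ?_, ?_⟩⟩, fun z hz => ?_,
    Set.Subset.antisymm (fun z hz => ?_) fun z hz => ?_, fun z hz => ?_⟩,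
    fun X Y α hα β hβ => ⟨fun z hz => ?_, fun k hk => ⟨fun z hz => ?_, ?_⟩⟩, fun z hz => ?_,
    Set.Subset.antisymm (fun z hz => ?_) fun z hz => ?_⟩
  · exact mem_diskSet_and_ovalSet_of_forall hn wRow_eq wCol_eq (hspec z hz) X Y hα hβ
  · exact mem_minSet_of_forall hn wRow_eq wCol_eq (hspec z hz) hk
  · exact minSet_subset_typeSet X Y hα hβ k
  · exact Set.mem_iInter₂.2 fun k hk => mem_minSet_of_forall hn wRow_eq wCol_eq (hspec z hz) hk
  · exact ⟨Set.mem_iInter₂.1 hz 22 (by simp), Set.mem_iInter₂.1 hz 23 (by simp)⟩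
  · exact Set.mem_iInter₂.2 fun k hk =>
      mem_minSet_of_forall hn wRow_eq wCol_eq (exists_le_of_mem_minSet (.inr rfl) hz.1) hk
  · exact Set.mem_iInter.2 fun X =>
      Set.mem_iUnion.2 (exists_le_of_mem_minSet (.inr rfl) hz.1 X)
  · exact mem_diskSet_and_ovalSet_of_forall hn wBlockRow_eq wBlockCol_eq (hspecB z hz) X Y hα hβ
  · exact mem_minSet_of_forall hn wBlockRow_eq wBlockCol_eq (hspecB z hz) hk
  · exact minSet_subset_typeSet X Y hα hβ k
  · exact Set.mem_iInter₂.2 fun k hk =>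
      mem_minSet_of_forall hn wBlockRow_eq wBlockCol_eq (hspecB z hz) hk
  · exact Set.mem_iInter₂.1 hz 18 (by simp)
  · exact Set.mem_iInter₂.2 fun k hk =>
      mem_minSet_of_forall hn wBlockRow_eq wBlockCol_eq (exists_le_of_mem_minSet (.inl rfl) hz) hk
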